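/- All rings are associative with identity and all modules are unitary. For a ring $R$ and a right $R$-module $T$, let $\mathrm{add}\,T$ be the class of right $R$-modules isomorphic to a direct summand of a finite direct sum of copies of $T$, and let $\mathrm{gen}^*(R)$ be the class of right $R$-modules $N$ for which there is an exact sequence $\cdots\xrightarrow{f_2} P_1\xrightarrow{f_1} P_0\xrightarrow{f_0} N\to 0$ with every $P_i$ in $\mathrm{add}\,R_R$ and $\mathrm{Ext}^1_R(R,\ker f_i)=0$ for all $i\ge 0$ (the last condition being automatic). The module $T$ is *Wakamatsu tilting* if (i) $T\in\mathrm{gen}^*(R)$; (ii) $\mathrm{Ext}^i_R(T,T)=0$ for all $i>0$; and (iii) there is an exact sequence $0\to R\to T_0\to T_1\to\cdots$ with all $T_i\in\mathrm{add}\,T$ which stays exact after applying $\mathrm{Hom}_R(-,T)$. For $n\ge 0$, it is *$n$-tilting* if (i) $T\in\mathrm{gen}^*(R)$ and $\mathrm{pd}(T_R)\le n$; (ii) $\mathrm{Ext}^i_R(T,T)=0$ for all $i>0$; and (iii) there is an exact sequence $0\to R\to T_0\to\cdots\to T_n\to 0$ with all $T_i\in\mathrm{add}\,T$. It is *tilting*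 if it is $n$-tilting for some $n$. The *Wakamatsu tilting conjecture holds for $R$* if every Wakamatsu tilting right $R$-module of finite projective dimension is tilting. A ring $R$ is *left max* if every nonzero left $R$-module has a maximal submodule, and *left Kasch* if for every maximal left ideal $\mathfrak n$ of $R$ there is a left ideal of $R$ isomorphic to $R/\mathfrak n$ as a left $R$-module. **Corollary.** The Wakamatsu tilting conjecture holds for $R$ in each of the following cases: 1. $R$ is left max and left Kasch; 2. $R$ is left Artinian with zero Jacobson radical (that is, $R$ is semisimple); 3. $R$ is a left Artinian local ring; 4. $R=A[G]$ is the group ring of a finite group $G$ over a commutative Artinian ring $A$. -/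

import Mathlib

universe u v

open CategoryTheory

/-! Right modules over a ring `R` are left modules over `Rᵐᵒᵖ`, as everywhere in Mathlib.  The
module-theoretic notions are therefore defined for left modules over an arbitrary ring `A`, and are
used with `A = Rᵐᵒᵖ`. -/

namespace WakamatsuTilting

section Modules

variable {A : Type u} [Ring A]

/-- `Ext^i_A(X, Y) = 0`. -/
def ExtVanishes (X Y : ModuleCat.{u} A) (i : ℕ) : Prop :=
  Subsingleton (Abelian.Ext.{u} X Y i)

/-- `X ∈ add T`: `X` is isomorphic to a direct summand of `T ⊕ ⋯ ⊕ T` (finitely many copies),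
i.e. it is a retract of some `T ^ k`. -/
def InAdd (T X : ModuleCat.{u} A) : Prop :=
  ∃ (k : ℕ) (s : X →ₗ[A] (Fin k → T)) (r : (Fin k → T) →ₗ[A] X), r ∘ₗ s = LinearMap.id

/-- `N ∈ gen*(T)`: there is an exact sequence `⋯ → T₂ → T₁ → T₀ → N → 0` with all `Tᵢ ∈ add T`,
such that `Ext¹(T, -)` vanishes on the kernel of each of its maps.  Here `ε` is the map `T₀ → N`
and `d i` is the map `Tᵢ₊₁ → Tᵢ`. -/
def InGenStar (T N : ModuleCat.{u} A) : Prop :=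
  ∃ (X : ℕ → ModuleCat.{u} A) (ε : X 0 →ₗ[A] N) (d : ∀ i, X (i + 1) →ₗ[A] X i),
    (∀ i, InAdd T (X i)) ∧
    Function.Surjective ε ∧
    Function.Exact (d 0) ε ∧
    (∀ i, Function.Exact (d (i + 1)) (d i)) ∧
    ExtVanishes T (ModuleCat.of A (LinearMap.ker ε)) 1 ∧
    (∀ i, ExtVanishes T (ModuleCat.of A (LinearMap.ker (d i))) 1)

/-- `T` is `n`-tilting. The exact sequence `0 → A → T₀ → ⋯ → Tₙ → 0` is written as an exact
sequence `0 → A → T₀ → T₁ → ⋯` with `Tᵢ = 0` for `i > n`. -/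
structure IsTilting (n : ℕ) (T : ModuleCat.{u} A) : Prop where
  genStar : InGenStar (ModuleCat.of A A) T
  projDim_le : HasProjectiveDimensionLE T n
  ext_self : ∀ i : ℕ, 0 < i → ExtVanishes T T i
  coresolution : ∃ (X : ℕ → ModuleCat.{u} A) (η : A →ₗ[A] X 0) (d : ∀ i, X i →ₗ[A] X (i + 1)),
    (∀ i, i ≤ n → InAdd T (X i)) ∧
    (∀ i, n < i → Subsingleton (X i)) ∧
    Function.Injective η ∧
    Function.Exact η (d 0) ∧
    (∀ i, Function.Exact (d i) (d (i + 1)))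

/-- `T` is a Wakamatsu tilting module. The last three clauses of `coresolution` say that the
sequence `⋯ → Hom(T₁, T) → Hom(T₀, T) → Hom(A, T) → 0` is exact. -/
structure IsWakamatsuTilting (T : ModuleCat.{u} A) : Prop where
  genStar : InGenStar (ModuleCat.of A A) T
  ext_self : ∀ i : ℕ, 0 < i → ExtVanishes T T i
  coresolution : ∃ (X : ℕ → ModuleCat.{u} A) (η : A →ₗ[A] X 0) (d : ∀ i, X i →ₗ[A] X (i + 1)),
    (∀ i, InAdd T (X i)) ∧
    Function.Injective η ∧
    Function.Exact η (d 0) ∧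
    (∀ i, Function.Exact (d i) (d (i + 1))) ∧
    Function.Surjective (fun h : X 0 →ₗ[A] T => h ∘ₗ η) ∧
    Function.Exact (fun h : X 1 →ₗ[A] T => h ∘ₗ d 0) (fun h : X 0 →ₗ[A] T => h ∘ₗ η) ∧
    (∀ i, Function.Exact (fun h : X (i + 2) →ₗ[A] T => h ∘ₗ d (i + 1))
      (fun h : X (i + 1) →ₗ[A] T => h ∘ₗ d i))

end Modules

/-- The Wakamatsu tilting conjecture holds for `R`: every Wakamatsu tilting right `R`-module of
finite projective dimension is tilting. -/
def WakamatsuTiltingConjecture (R : Type u) [Ring R] : Prop :=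
  ∀ T : ModuleCat.{u} Rᵐᵒᵖ, IsWakamatsuTilting T →
    (∃ m : ℕ, HasProjectiveDimensionLE T m) → ∃ n : ℕ, IsTilting n T

/-- `R` is left Kasch: for every maximal left ideal `𝔫`, some left ideal is isomorphic to `R/𝔫`
as a left `R`-module (for a noncommutative ring, `Ideal R` is the type of left ideals). -/
def IsLeftKasch (R : Type u) [Ring R] : Prop :=
  ∀ 𝔫 : Ideal R, 𝔫.IsMaximal → ∃ I : Ideal R, Nonempty ((R ⧸ 𝔫) ≃ₗ[R] I)

/-- `R` is a left max ring: every nonzero left `R`-module has a maximal submodule. -/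
def IsLeftMax (R : Type u) [Ring R] : Prop :=
  ∀ (M : Type u) [AddCommGroup M] [Module R M], Nontrivial M → ∃ N : Submodule R M, IsCoatom N

end WakamatsuTilting

/-!
The four cases have one common cause: each of the rings is left Kasch, and over a left Kasch ring
the finitely generated projective right modules satisfy Bass' criterion
(`exists_leftInverse_of_injective`): every injective map `f : P → Q` between them splits. To see
this, dualize into `R`. If `Hom(Q, R) → Hom(P, R)` were not surjective, its image would lie in a
maximal submodule of the finitely generated left module `Hom(P, R)`, and the simple quotient would
embed in `R`. That gives a nonzero functional on `Hom(P, R)` killing the image; as `P` is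
reflexive, it is evaluation at some `p ≠ 0`, and then every functional on `Q` kills `f p`, so
`f p = 0`, a contradiction. Surjectivity lets the coordinates of a dual basis of `P` extend to `Q`,
which yields the retraction.

Consequently a module with a resolution by finitely generated projectives and finite projective
dimension is projective (`projective_of_resolution`): the syzygies split off one after the other.
A Wakamatsu tilting module `T` of finite projective dimension is therefore projective, so the
embedding of the ring in `T₀ ∈ add T` splits and the ring itself lies in `add T`, which makes `T`
a `0`-tilting module.

For a group ring `A[G]` over a commutative Artinian ring, a simple module `S` is finite over `A`
and so has a nonzero `A`-linear functional `φ`; the map `s ↦ ∑ g, φ (g⁻¹ s) g` then embeds `S`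
in `A[G]`.
-/

open CategoryTheory

namespace WakamatsuTilting

/-! ### Injective maps of projectives over a left Kasch ring -/

section Kasch

variable {R : Type u} [Ring R]

/-- A proper submodule of a finitely generated module lies in a maximal one, and over a left Kasch
ring the simple quotient by the latter embeds in the ring. -/
theorem IsLeftKasch.exists_ne_zero_of_ne_top (hR : IsLeftKasch R) {M : Type*} [AddCommGroup M]
    [Module R M] [Module.Finite R M] {N : Submodule R M} (hN : N ≠ ⊤) :
    ∃ f : M →ₗ[R] R, f ≠ 0 ∧ ∀ x ∈ N, f x = 0 := by
  obtain ⟨L, hL, hNL⟩ := (eq_top_or_exists_le_coatom N).resolve_left hN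
  have hsimple : IsSimpleModule R (M ⧸ L) := isSimpleModule_iff_isCoatom.2 hL
  obtain ⟨𝔫, h𝔫, ⟨e⟩⟩ := isSimpleModule_iff_quot_maximal.1 hsimple
  obtain ⟨I, ⟨e'⟩⟩ := hR 𝔫 h𝔫
  refine ⟨I.subtype ∘ₗ (e.trans e').toLinearMap ∘ₗ L.mkQ, fun h => hL.1 ?_, fun x hx => ?_⟩
  · refine eq_top_iff.2 fun x _ => ?_
    have := LinearMap.congr_fun h x
    simpa using this
  · have : L.mkQ x = 0 := by simpa using hNL hx
    simp [this]

/-- `R` as a right module over itself is the regular left module of `Rᵐᵒᵖ`. -/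
def unopEquiv (R : Type u) [Ring R] : Rᵐᵒᵖ ≃ₗ[Rᵐᵒᵖ] R where
  toFun := MulOpposite.unop
  invFun := MulOpposite.op
  map_add' _ _ := rfl
  map_smul' _ _ := rfl
  left_inv _ := rfl
  right_inv _ := rfl

theorem exists_dualBasis (P : Type*) [AddCommGroup P] [Module Rᵐᵒᵖ P] [Module.Finite Rᵐᵒᵖ P]
    [Module.Projective Rᵐᵒᵖ P] :
    ∃ (k : ℕ) (x : Fin k → P) (φ : Fin k → (P →ₗ[Rᵐᵒᵖ] R)),
      ∀ p, ∑ i, MulOpposite.op (φ i p) • x i = p := by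
  obtain ⟨k, r, hr⟩ := Module.Finite.exists_fin' Rᵐᵒᵖ P
  obtain ⟨s, hs⟩ := Module.projective_lifting_property r LinearMap.id hr
  refine ⟨k, fun i => r (Pi.single i 1),
    fun i => (unopEquiv R).toLinearMap ∘ₗ LinearMap.proj i ∘ₗ s, fun p => ?_⟩
  conv_rhs => rw [← LinearMap.id_apply (R := Rᵐᵒᵖ) p, ← hs, LinearMap.comp_apply,
    pi_eq_sum_univ' (s p), map_sum]
  refine Finset.sum_congr rfl fun i _ => ?_
  rw [map_smul]
  rfl

/-- A dual basis of a right module exhibits the dual, a left module, as generated by the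
coordinates. -/
theorem dual_eq_sum {P : Type*} [AddCommGroup P] [Module Rᵐᵒᵖ P] {k : ℕ} {x : Fin k → P}
    {φ : Fin k → (P →ₗ[Rᵐᵒᵖ] R)} (hφ : ∀ p, ∑ i, MulOpposite.op (φ i p) • x i = p)
    (ψ : P →ₗ[Rᵐᵒᵖ] R) : ψ = ∑ i, ψ (x i) • φ i := by
  ext p
  conv_lhs => rw [← hφ p]
  simp

/-- Over a left Kasch ring, an injective map from a finitely generated projective right module to
a projective one splits. -/
theorem IsLeftKasch.exists_leftInverse_of_injective (hR : IsLeftKasch R) {P Q : Type*}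
    [AddCommGroup P] [Module Rᵐᵒᵖ P] [Module.Finite Rᵐᵒᵖ P] [Module.Projective Rᵐᵒᵖ P]
    [AddCommGroup Q] [Module Rᵐᵒᵖ Q] [Module.Projective Rᵐᵒᵖ Q]
    (f : P →ₗ[Rᵐᵒᵖ] Q) (hf : Function.Injective f) :
    ∃ g : Q →ₗ[Rᵐᵒᵖ] P, g ∘ₗ f = LinearMap.id := by
  obtain ⟨k, x, φ, hφ⟩ := exists_dualBasis (R := R) P
  let dual : (Q →ₗ[Rᵐᵒᵖ] R) →ₗ[R] (P →ₗ[Rᵐᵒᵖ] R) :=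
    { toFun := fun ψ => ψ ∘ₗ f
      map_add' := fun _ _ => rfl
      map_smul' := fun _ _ => rfl }
  have hfin : Module.Finite R (P →ₗ[Rᵐᵒᵖ] R) :=
    .of_surjective (Fintype.linearCombination R φ) fun ψ =>
      ⟨fun i => ψ (x i), (dual_eq_sum hφ ψ).symm⟩
  have hsurj : LinearMap.range dual = ⊤ := by
    by_contra hne
    obtain ⟨Φ, hΦ, hker⟩ := hR.exists_ne_zero_of_ne_top hne
    -- by reflexivity of `P`, the functional `Φ` is evaluation at `p`
    let p : P := ∑ i, MulOpposite.op (Φ (φ i)) • x i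
    have heval : ∀ ψ : P →ₗ[Rᵐᵒᵖ] R, Φ ψ = ψ p := fun ψ => by
      conv_lhs => rw [dual_eq_sum hφ ψ]
      simp [p]
    have hfp : f p = 0 := by
      refine (Module.forall_dual_apply_eq_zero_iff Rᵐᵒᵖ (f p)).1 fun χ => ?_
      have := hker (dual ((unopEquiv R).toLinearMap ∘ₗ χ)) ⟨_, rfl⟩
      rw [heval] at this
      exact (unopEquiv R).map_eq_zero_iff.1 this
    have hp : p = 0 := hf (by rw [hfp, map_zero])
    exact hΦ (LinearMap.ext fun ψ => by rw [heval, hp, map_zero, LinearMap.zero_apply])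
  choose ψ hψ using fun i => LinearMap.range_eq_top.1 hsurj (φ i)
  refine ⟨∑ i, (LinearMap.toSpanSingleton Rᵐᵒᵖ P (x i)) ∘ₗ (unopEquiv R).symm.toLinearMap ∘ₗ ψ i,
    LinearMap.ext fun p => ?_⟩
  conv_rhs => rw [LinearMap.id_apply, ← hφ p]
  simp only [LinearMap.comp_apply, LinearMap.sum_apply]
  refine Finset.sum_congr rfl fun i _ => ?_
  rw [← hψ i]
  rfl

end Kasch

/-! ### Projectivity of modules of finite projective dimension -/

section Tilting

theorem InAdd.finite {A : Type u} [Ring A] {T X : ModuleCat.{u} A} [Module.Finite A T]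
    (h : InAdd T X) : Module.Finite A X := by
  obtain ⟨k, s, r, hr⟩ := h
  exact Module.Finite.of_surjective r fun x => ⟨s x, LinearMap.congr_fun hr x⟩

theorem InAdd.projective {A : Type u} [Ring A] {T X : ModuleCat.{u} A} [Module.Projective A T]
    (h : InAdd T X) : Module.Projective A X := by
  obtain ⟨k, s, r, hr⟩ := h
  have : Module.Projective A (Fin k → T) :=
    .of_equiv (DFinsupp.linearEquivFunOnFintype (R := A) (M := fun _ : Fin k => T))
  exact Module.Projective.of_split s r hr

variable {R : Type u} [Ring R]

/-- Over a left Kasch ring, a right module of finite projective dimension with a resolution by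
finitely generated projectives is projective. -/
theorem IsLeftKasch.projective_of_resolution (hR : IsLeftKasch R) (m : ℕ)
    (N : ModuleCat.{u} Rᵐᵒᵖ) [HasProjectiveDimensionLE N m] (X : ℕ → ModuleCat.{u} Rᵐᵒᵖ)
    (ε : X 0 →ₗ[Rᵐᵒᵖ] N) (d : ∀ i, X (i + 1) →ₗ[Rᵐᵒᵖ] X i)
    (hfin : ∀ i, Module.Finite Rᵐᵒᵖ (X i)) (hproj : ∀ i, Module.Projective Rᵐᵒᵖ (X i))
    (hε : Function.Surjective ε) (hdε : Function.Exact (d 0) ε)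
    (hd : ∀ i, Function.Exact (d (i + 1)) (d i)) : Module.Projective Rᵐᵒᵖ N := by
  induction m generalizing N X with
  | zero =>
    rw [IsProjective.iff_projective]
    exact (projective_iff_hasProjectiveDimensionLE_zero N).2 inferInstance
  | succ m ih =>
    have hSE : ε.shortComplexKer.ShortExact := LinearMap.shortExact_shortComplexKer hε
    have hX0 : CategoryTheory.Projective (X 0) := by
      have := hproj 0
      exact (IsProjective.iff_projective _).1 this
    have hK : HasProjectiveDimensionLE (ModuleCat.of Rᵐᵒᵖ (LinearMap.ker ε)) m :=
      (hSE.hasProjectiveDimensionLT_X₃_iff m hX0).1 ‹_›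
    have hmem : ∀ y, d 0 y ∈ LinearMap.ker ε := fun y => (hdε _).2 ⟨y, rfl⟩
    let ε' : X 1 →ₗ[Rᵐᵒᵖ] LinearMap.ker ε := (d 0).codRestrict _ hmem
    have hε' : Function.Surjective ε' := fun ⟨y, hy⟩ => by
      obtain ⟨z, hz⟩ := (hdε y).1 hy
      exact ⟨z, Subtype.ext hz⟩
    have hKproj : Module.Projective Rᵐᵒᵖ (LinearMap.ker ε) :=
      ih (ModuleCat.of Rᵐᵒᵖ (LinearMap.ker ε)) (fun i => X (i + 1)) ε' (fun i => d (i + 1))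
        (fun i => hfin _) (fun i => hproj _) hε'
        (fun y => by rw [← hd 0 y]; exact Subtype.ext_iff) (fun i => hd _)
    have := hfin 1
    have := hproj 0
    have hKfin : Module.Finite Rᵐᵒᵖ (LinearMap.ker ε) := Module.Finite.of_surjective ε' hε'
    obtain ⟨g, hg⟩ := hR.exists_leftInverse_of_injective (LinearMap.ker ε).subtype
      Subtype.val_injective
    have hexact : Function.Exact (LinearMap.ker ε).subtype ε := LinearMap.exact_subtype_ker_map ε
    have hsplit := (hexact.split_tfae Subtype.val_injective hε).out 1 0
    obtain ⟨s, hs⟩ := hsplit.1 ⟨g, hg⟩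
    exact Module.Projective.of_split s ε hs

/-- Over a left Kasch ring, Wakamatsu tilting right modules of finite projective dimension are
even `0`-tilting. -/
theorem IsLeftKasch.wakamatsuTiltingConjecture (hR : IsLeftKasch R) :
    WakamatsuTiltingConjecture R := by
  rintro T hT ⟨m, hm⟩
  have hadd : ∀ {Y : ModuleCat.{u} Rᵐᵒᵖ}, InAdd (ModuleCat.of Rᵐᵒᵖ Rᵐᵒᵖ) Y →
      Module.Finite Rᵐᵒᵖ Y ∧ Module.Projective Rᵐᵒᵖ Y := fun h =>
    have : Module.Finite Rᵐᵒᵖ (ModuleCat.of Rᵐᵒᵖ Rᵐᵒᵖ) := inferInstanceAs (Module.Finite Rᵐᵒᵖ Rᵐᵒᵖ)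
    have : Module.Projective Rᵐᵒᵖ (ModuleCat.of Rᵐᵒᵖ Rᵐᵒᵖ) :=
      inferInstanceAs (Module.Projective Rᵐᵒᵖ Rᵐᵒᵖ)
    ⟨h.finite, h.projective⟩
  have hproj : Module.Projective Rᵐᵒᵖ T := by
    obtain ⟨X, ε, d, hX, hε, hdε, hd, -, -⟩ := hT.genStar
    exact hR.projective_of_resolution m T X ε d (fun i => (hadd (hX i)).1)
      (fun i => (hadd (hX i)).2) hε hdε hd
  obtain ⟨X, η, d, hX, hη, -⟩ := hT.coresolution
  have := (hX 0).projective
  obtain ⟨g, hg⟩ := hR.exists_leftInverse_of_injective η hη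
  obtain ⟨k, s, r, hr⟩ := hX 0
  have hRT : InAdd T (ModuleCat.of Rᵐᵒᵖ Rᵐᵒᵖ) :=
    ⟨k, s ∘ₗ η, g ∘ₗ r, LinearMap.ext fun a => by
      have h1 := LinearMap.congr_fun hr (η a)
      have h2 := LinearMap.congr_fun hg a
      simp only [LinearMap.comp_apply, LinearMap.id_apply] at h1 h2 ⊢
      rw [h1, h2]⟩
  refine ⟨0, hT.genStar, ?_, hT.ext_self, ?_⟩
  · exact (projective_iff_hasProjectiveDimensionLE_zero T).1
      ((IsProjective.iff_projective _).1 hproj)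
  -- the coresolution `0 → R → R → 0`
  · refine ⟨fun i => i.casesOn (ModuleCat.of Rᵐᵒᵖ Rᵐᵒᵖ) fun _ => ModuleCat.of Rᵐᵒᵖ PUnit,
      LinearMap.id, fun i => 0, ?_, ?_, Function.injective_id, ?_, ?_⟩
    · rintro i hi
      obtain rfl : i = 0 := by omega
      exact hRT
    · rintro (_ | i) hi
      · omega
      · exact inferInstanceAs (Subsingleton PUnit)
    · exact fun y => ⟨fun _ => ⟨y, rfl⟩, fun _ => rfl⟩
    · exact fun i y => ⟨fun _ => ⟨0, Subsingleton.elim (α := PUnit) _ _⟩, fun _ => rfl⟩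

end Tilting

/-! ### Left Kasch rings -/

theorem isLeftKasch_of_exists_ne_zero {R : Type*} [Ring R]
    (h : ∀ 𝔫 : Ideal R, 𝔫.IsMaximal → ∃ f : (R ⧸ 𝔫) →ₗ[R] R, f ≠ 0) : IsLeftKasch R := by
  intro 𝔫 h𝔫
  have : IsSimpleModule R (R ⧸ 𝔫) := isSimpleModule_iff_isCoatom.2 h𝔫.out
  obtain ⟨f, hf⟩ := h 𝔫 h𝔫
  exact ⟨LinearMap.range f, ⟨LinearEquiv.ofInjective f (LinearMap.injective_of_ne_zero hf)⟩⟩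

theorem isLeftKasch_of_isSemisimpleRing (R : Type*) [Ring R] [IsSemisimpleRing R] :
    IsLeftKasch R := fun 𝔫 _ =>
  have ⟨P, ⟨e⟩⟩ := IsSemisimpleModule.exists_submodule_linearEquiv_quotient 𝔫
  ⟨P, ⟨e.symm⟩⟩

theorem eq_of_isMaximal_of_isLocalRing {R : Type*} [Ring R] [IsLocalRing R] {I J : Ideal R}
    (hI : I.IsMaximal) (hJ : J.IsMaximal) : I = J := by
  by_contra hne
  have hsup : I ⊔ J = ⊤ := hI.out.sup_eq_top_of_ne hJ.out hne
  obtain ⟨a, ha, b, hb, hab⟩ := Submodule.mem_sup.1 (hsup ▸ Submodule.mem_top : (1 : R) ∈ I ⊔ J)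
  rcases IsLocalRing.isUnit_or_isUnit_of_add_one hab with h | h
  · exact hI.ne_top (I.eq_top_of_isUnit_mem ha h)
  · exact hJ.ne_top (J.eq_top_of_isUnit_mem hb h)

/-- A minimal left ideal is isomorphic to `R/𝔪` for a maximal left ideal `𝔪`, and there is only
one such `𝔪`. -/
theorem isLeftKasch_of_isLocalRing (R : Type*) [Ring R] [IsArtinianRing R] [IsLocalRing R] :
    IsLeftKasch R := by
  intro 𝔫 h𝔫
  obtain ⟨S, hS⟩ := IsAtomic.exists_atom (Ideal R)
  obtain ⟨𝔪, h𝔪, ⟨e⟩⟩ := isSimpleModule_iff_quot_maximal.1 (isSimpleModule_iff_isAtom.2 hS)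
  obtain rfl := eq_of_isMaximal_of_isLocalRing h𝔫 h𝔪
  exact ⟨S, ⟨e.symm⟩⟩

theorem isLeftKasch_of_isArtinianRing (A : Type*) [CommRing A] [IsArtinianRing A] :
    IsLeftKasch A := by
  refine isLeftKasch_of_exists_ne_zero fun 𝔪 h𝔪 => ?_
  have hmin : 𝔪 ∈ (Module.annihilator A A).minimalPrimes :=
    ⟨⟨h𝔪.isPrime, (Module.annihilator_eq_bot.2 inferInstance).trans_le bot_le⟩, fun q ⟨_, _⟩ hq =>
      ((IsArtinianRing.isMaximal_of_isPrime q).eq_of_le h𝔪.ne_top hq).ge⟩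
  obtain ⟨f, hf⟩ := (isAssociatedPrime_iff_exists_injective_linearMap 𝔪 A).1
    (Module.associatedPrimes.minimalPrimes_annihilator_subset_associatedPrimes A A hmin) |>.2
  refine ⟨f, fun h0 => h𝔪.ne_top (Ideal.Quotient.subsingleton_iff.1 ⟨fun a b => hf ?_⟩)⟩
  rw [h0, LinearMap.zero_apply, LinearMap.zero_apply]

section GroupRing

variable {A : Type*} [CommRing A] {G : Type*} [Group G] [Fintype G]

/-- The `A[G]`-linear map `s ↦ ∑ g, φ (g⁻¹ s) g` induced by an `A`-linear functional `φ`: one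
direction of the isomorphism `Hom_A(S, A) ≃ Hom_{A[G]}(S, A[G])`. -/
noncomputable def coinduce {S : Type*} [AddCommGroup S] [Module (MonoidAlgebra A G) S] [Module A S]
    [IsScalarTower A (MonoidAlgebra A G) S] (φ : S →ₗ[A] A) : S →ₗ[MonoidAlgebra A G]
      MonoidAlgebra A G where
  toFun s := ∑ g : G, MonoidAlgebra.single g (φ (MonoidAlgebra.single g⁻¹ (1 : A) • s))
  map_add' s t := by
    simp [smul_add, MonoidAlgebra.single_add, Finset.sum_add_distrib]
  map_smul' x s := by
    induction x using MonoidAlgebra.induction_linear with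
    | zero => simp
    | add x y hx hy =>
      simp only [RingHom.id_apply] at hx hy ⊢
      rw [add_smul x y (∑ g : G, _), ← hx, ← hy, ← Finset.sum_add_distrib]
      simp [add_smul, smul_add, MonoidAlgebra.single_add]
    | single h a =>
      simp only [RingHom.id_apply, smul_eq_mul, Finset.mul_sum, MonoidAlgebra.single_mul_single]
      rw [← Equiv.sum_comp (Equiv.mulLeft h)]
      refine Finset.sum_congr rfl fun g _ => ?_
      have : (MonoidAlgebra.single (h * g)⁻¹ (1 : A)) * MonoidAlgebra.single h a
          = a • MonoidAlgebra.single g⁻¹ (1 : A) := by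
        simp [MonoidAlgebra.single_mul_single]
      rw [Equiv.coe_mulLeft, smul_smul, this, smul_assoc, map_smul, smul_eq_mul]

theorem coeff_one_coinduce {S : Type*} [AddCommGroup S] [Module (MonoidAlgebra A G) S] [Module A S]
    [IsScalarTower A (MonoidAlgebra A G) S] (φ : S →ₗ[A] A) (s : S) :
    (coinduce (G := G) φ s).coeff 1 = φ s := by
  classical
  have h1 : (MonoidAlgebra.single 1 (1 : A) : MonoidAlgebra A G) • s = s := one_smul _ s
  simp [coinduce, MonoidAlgebra.coeff_sum, Finsupp.single_apply, h1]

end GroupRing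

theorem isLeftKasch_monoidAlgebra (A : Type*) [CommRing A] [IsArtinianRing A] (G : Type*)
    [Group G] [Finite G] : IsLeftKasch (MonoidAlgebra A G) := by
  have := Fintype.ofFinite G
  refine isLeftKasch_of_exists_ne_zero fun 𝔫 h𝔫 => ?_
  have : Module.Finite A (MonoidAlgebra A G ⧸ 𝔫) :=
    Module.Finite.of_surjective (𝔫.mkQ.restrictScalars A) 𝔫.mkQ_surjective
  have : Nontrivial (MonoidAlgebra A G ⧸ 𝔫) := Submodule.Quotient.nontrivial_iff.2 h𝔫.ne_top
  obtain ⟨φ, hφ, -⟩ := (isLeftKasch_of_isArtinianRing A).exists_ne_zero_of_ne_top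
    (M := MonoidAlgebra A G ⧸ 𝔫) (N := ⊥) bot_ne_top
  refine ⟨coinduce φ, fun h => hφ (LinearMap.ext fun s => ?_)⟩
  rw [← coeff_one_coinduce (G := G) φ s, h]
  rfl

end WakamatsuTilting

theorem corollary1p2 :
    (∀ (R : Type u) [Ring R], WakamatsuTilting.IsLeftMax R → WakamatsuTilting.IsLeftKasch R →
      WakamatsuTilting.WakamatsuTiltingConjecture R) ∧
    (∀ (R : Type u) [Ring R], IsArtinianRing R → Ring.jacobson R = ⊥ →
      WakamatsuTilting.WakamatsuTiltingConjecture R) ∧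
    (∀ (R : Type u) [Ring R], IsArtinianRing R → IsLocalRing R →
      WakamatsuTilting.WakamatsuTiltingConjecture R) ∧
    (∀ (A : Type u) [CommRing A] (G : Type v) [Group G], IsArtinianRing A → Finite G →
      WakamatsuTilting.WakamatsuTiltingConjecture (MonoidAlgebra A G)) := by

  refine ⟨fun R _ _ hR => hR.wakamatsuTiltingConjecture, fun R _ _ hJ => ?_, fun R _ _ _ => ?_,
    fun A _ G _ _ _ => ?_⟩
  · have := IsArtinianRing.isSemisimpleRing_iff_jacobson.2 hJ
    exact (WakamatsuTilting.isLeftKasch_of_isSemisimpleRing R).wakamatsuTiltingConjecture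
  · exact (WakamatsuTilting.isLeftKasch_of_isLocalRing R).wakamatsuTiltingConjecture
  · exact (WakamatsuTilting.isLeftKasch_monoidAlgebra A G).wakamatsuTiltingConjecture
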